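/- Let $p$ be a prime number, let $q$ be a variable, and let $\mathfrak m=(p,1-q)\subset\mathbb Z[q]$, a maximal ideal. Let $\mathbb Z_{q,p}$ be the completion of the local ring $\mathbb Z[q]_{\mathfrak m}$ for the $\mathfrak m$-adic norm $|\cdot|_{\mathfrak m}$ (where $|x|_{\mathfrak m}=p^{-n}$ if $x\in\mathfrak m^n\setminus\mathfrak m^{n+1}$, and $|0|_{\mathfrak m}=0$), and let $\mathbf F_q:\mathbb Z_{q,p}\to\mathbb Z_{q,p}$ be the continuous ring endomorphism extending $P(q)/Q(q)\mapsto P(q^p)/Q(q^p)$. For $\beta\in\mathbb Z_p$ let $q^\beta\in\mathbb Z_{q,p}$ be the limit of $q^{\beta_n}$, where $\beta_n\in\mathbb N$ are the truncations of the $p$-adic expansion of $\beta$. Let $S$ be the set of all $Q\in\mathbb Z_{q,p}[z]$ with $|Q(0)|_{\mathfrak m}=1$, and let $E_{\mathbb Z,q,p}\subset\mathbb Z_{q,p}[[z]]$ be the completion of the localization $\mathbb Z_{q,p}[z]_S$ for the Gauss norm $\left|\sum a_nz^n\right|=\sup_n|a_n|_{\mathfrak m}$. On $\mathbb Z_{q,p}[[z]]$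 and on $E_{\mathbb Z,q,p}$ put $\sigma_q\left(\sum a_nz^n\right)=\sum a_nq^nz^n$ and $\mathbf F_q\left(\sum a_nz^n\right)=\sum\mathbf F_q(a_n)z^{np}$. An operator $\sigma_q^n+a_1\sigma_q^{n-1}+\dots+a_n$ with coefficients in $E_{\mathbb Z,q,p}$ and companion matrix $A$ has a strong Frobenius structure for $p$ with period $h\ge1$ if there is $H\in\mathrm{GL}_n(E_{\mathbb Z,q,p})$, called a Frobenius transition matrix, with $\sigma_q(H)\,A^{\mathbf F_q^h}=A\,H$, where $A^{\mathbf F_q^h}$ is obtained by applying $\mathbf F_q$ to each entry of $A$ $h$ times. Theorem. Let $\alpha=a/b\in\mathbb Q\cap(0,1]$ and suppose that $p\equiv1\bmod b$. Then the order-one $q$-hypergeometric operator $\sigma_q-\frac{1-z}{1-q^\alpha z}$, which has its coefficient in $E_{\mathbb Z,q,p}$, has a strong Frobenius structure for $p$ with period $1$. More precisely, for every $n\ge0$ the quotient $\frac{(q^\alpha;q)_n}{(q;q)_n}$, where $(x;q)_n=\prod_{k=0}^{n-1}(1-xq^k)$, is a well-defined element of $\mathbb Z_{q,p}$; and for the power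 series $f_\alpha=\sum_{n\ge0}\frac{(q^\alpha;q)_n}{(q;q)_n}z^n\in\mathbb Z_{q,p}[[z]]$, the series $\mathbf F_q(f_\alpha)$ is invertible in $\mathbb Z_{q,p}[[z]]$, the quotient $f_\alpha/\mathbf F_q(f_\alpha)$ is a unit of $E_{\mathbb Z,q,p}$, and it is a Frobenius transition matrix of period $1$ for this operator. -/

import Mathlib

namespace QFrob

open Polynomial

noncomputable section

variable (p : ℕ)

/-! ### The local ring `ℤ[q]_𝔪` and its Frobenius endomorphism

In `ℤ[X]` the polynomial variable `X` plays the role of `q`. -/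

/-- The ideal `𝔪 = (p, 1 - q)` of `ℤ[q]`. -/
def mIdeal : Ideal ℤ[X] := Ideal.span {(p : ℤ[X]), 1 - X}

theorem mIdeal_eq_ker :
    mIdeal p = RingHom.ker ((Int.castRingHom (ZMod p)).comp (evalRingHom (1 : ℤ))) := by
  apply le_antisymm
  · rw [mIdeal, Ideal.span_le]
    rintro x (rfl | rfl) <;> simp [RingHom.mem_ker]
  · intro x hx
    have h1 : (p : ℤ) ∣ x.eval 1 := by
      rw [← ZMod.intCast_zmod_eq_zero_iff_dvd]
      simpa [RingHom.mem_ker] using hx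
    obtain ⟨c, hc⟩ := h1
    obtain ⟨d, hd⟩ := X_sub_C_dvd_sub_C_eval (a := (1 : ℤ)) (p := x)
    have hx' : x = (p : ℤ[X]) * C c + (1 - X) * (-d) := by
      have : x = C (x.eval 1) + (X - C 1) * d := by rw [← hd]; ring
      rw [this, hc]
      simp
      ring
    rw [hx']
    exact Ideal.add_mem _
      (Ideal.mul_mem_right _ _ (Ideal.subset_span (by simp)))
      (Ideal.mul_mem_right _ _ (Ideal.subset_span (by simp)))

theorem mIdeal_eq_comap_expand :
    mIdeal p = (mIdeal p).comap (expand ℤ p : ℤ[X] →+* ℤ[X]) := by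
  ext x
  simp [mIdeal_eq_ker, RingHom.mem_ker, expand_eval]

variable [Fact p.Prime]

instance mIdeal_isPrime : (mIdeal p).IsPrime := by
  rw [mIdeal_eq_ker]
  exact RingHom.ker_isPrime _

/-- The local ring `ℤ[q]_𝔪`. -/
abbrev Zqm : Type := Localization.AtPrime (mIdeal p)

/-- The maximal ideal `𝔪 ℤ[q]_𝔪`. -/
abbrev maxIdeal : Ideal (Zqm p) := IsLocalRing.maximalIdeal (Zqm p)

/-- The endomorphism `P(q) / Q(q) ↦ P(q ^ p) / Q(q ^ p)` of `ℤ[q]_𝔪`. -/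
def frobZqm : Zqm p →+* Zqm p :=
  Localization.localRingHom (mIdeal p) (mIdeal p) (expand ℤ p : ℤ[X] →+* ℤ[X])
    (mIdeal_eq_comap_expand p)

theorem maxIdeal_le_comap : maxIdeal p ≤ (maxIdeal p).comap (frobZqm p) := by
  have h : IsLocalHom (frobZqm p) :=
    Localization.isLocalHom_localRingHom _ _ _ (mIdeal_eq_comap_expand p)
  exact ((IsLocalRing.local_hom_TFAE (frobZqm p)).out 0 3).mp h

theorem maxIdeal_pow_le_comap (n : ℕ) :
    maxIdeal p ^ n ≤ (maxIdeal p ^ n).comap (frobZqm p) :=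
  (Ideal.pow_right_mono (maxIdeal_le_comap p) n).trans (Ideal.le_comap_pow _ _)

/-! ### The completion `ℤ_{q,p}` -/

/-- `ℤ_{q,p}`: the completion of `ℤ[q]_𝔪` with respect to the `𝔪`-adic norm. -/
abbrev Zqp : Type := AdicCompletion (maxIdeal p) (Zqm p)

/-- Reduction modulo the `n`-th step of the `𝔪`-adic filtration of `ℤ_{q,p}`, that is, modulo the
closure of `𝔪 ^ n` in `ℤ_{q,p}`. -/
abbrev red (n : ℕ) : Zqp p →+* Zqm p ⧸ maxIdeal p ^ n :=
  (AdicCompletion.evalₐ (maxIdeal p) n : Zqp p →+* Zqm p ⧸ maxIdeal p ^ n)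

/-- The `𝔪`-adic norm on `ℤ_{q,p}`: `|x| = p ^ (-n)` if `x` lies in the `n`-th but not in the
`(n+1)`-st step of the `𝔪`-adic filtration, and `|0| = 0`. -/
def mNorm (x : Zqp p) : ℝ :=
  ⨅ n : {n : ℕ // red p n x = 0}, ((p : ℝ) ^ (n : ℕ))⁻¹

/-- The endomorphism induced by `P(q) / Q(q) ↦ P(q ^ p) / Q(q ^ p)` modulo `𝔪 ^ n`. -/
def frobMod (n : ℕ) : Zqm p ⧸ maxIdeal p ^ n →+* Zqm p ⧸ maxIdeal p ^ n :=
  Ideal.quotientMap (maxIdeal p ^ n) (frobZqm p) (maxIdeal_pow_le_comap p n)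

theorem frobMod_compat {m n : ℕ} (hle : m ≤ n) :
    (Ideal.Quotient.factorPow (maxIdeal p) hle).comp ((frobMod p n).comp (red p n)) =
      (frobMod p m).comp (red p m) := by
  ext x
  obtain ⟨y, rfl⟩ := AdicCompletion.mk_surjective _ _ x
  simp only [frobMod, RingHom.comp_apply, RingHom.coe_coe, AdicCompletion.evalₐ_mk,
    Ideal.quotientMap_mk]
  have h := Ideal.Quotient.eq.mp (AdicCompletion.Ideal.mk_eq_mk (maxIdeal p) hle y)
  change Ideal.Quotient.mk _ _ = Ideal.Quotient.mk _ _
  rw [Ideal.Quotient.eq, ← map_sub]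
  exact maxIdeal_pow_le_comap p m h

/-- The continuous extension `𝐅_q` of `P(q) / Q(q) ↦ P(q ^ p) / Q(q ^ p)` to `ℤ_{q,p}`. -/
def frob : Zqp p →+* Zqp p :=
  AdicCompletion.liftRingHom (maxIdeal p) (fun n => (frobMod p n).comp (red p n))
    (frobMod_compat p)

theorem red_frob (n : ℕ) (x : Zqp p) : red p n (frob p x) = frobMod p n (red p n x) :=
  AdicCompletion.evalₐ_liftRingHom _ _ (frobMod_compat p) n x

/-- The element `q` of `ℤ[q]_𝔪`. -/
def qm : Zqm p := algebraMap ℤ[X] (Zqm p) X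

/-- The element `q` of `ℤ_{q,p}`. -/
def q : Zqp p := AdicCompletion.of (maxIdeal p) (Zqm p) (qm p)

theorem algebraMap_mem_maxIdeal {x : ℤ[X]} (hx : x ∈ mIdeal p) :
    algebraMap ℤ[X] (Zqm p) x ∈ maxIdeal p :=
  (IsLocalization.AtPrime.to_map_mem_maximal_iff (Zqm p) (mIdeal p) x).mpr hx

theorem qm_pow_sub_one_mem (n : ℕ) : qm p ^ p ^ n - 1 ∈ maxIdeal p ^ n := by
  induction n with
  | zero => simp
  | succ n ih =>
    have h : qm p ^ p ^ (n + 1) - 1 =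
        (qm p ^ p ^ n - 1) * algebraMap ℤ[X] (Zqm p) (∑ i ∈ Finset.range p, (X ^ p ^ n) ^ i) := by
      have := mul_geom_sum (qm p ^ p ^ n) p
      rw [pow_succ, pow_mul, ← this]
      simp [qm]
    rw [h, pow_succ]
    refine Ideal.mul_mem_mul ih (algebraMap_mem_maxIdeal p ?_)
    simp [mIdeal_eq_ker, RingHom.mem_ker]

theorem qm_pow_sub_pow_mem {n a b : ℕ} (hab : a ≤ b) (h : p ^ n ∣ b - a) :
    qm p ^ a - qm p ^ b ∈ maxIdeal p ^ n := by
  obtain ⟨c, hc⟩ := h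
  obtain rfl : b = a + p ^ n * c := by omega
  have h1 : qm p ^ p ^ n - 1 ∣ (qm p ^ p ^ n) ^ c - 1 := by
    simpa using sub_dvd_pow_sub_pow (qm p ^ p ^ n) 1 c
  have h2 : qm p ^ a - qm p ^ (a + p ^ n * c) = -(qm p ^ a) * ((qm p ^ p ^ n) ^ c - 1) := by
    rw [pow_add, pow_mul]; ring
  rw [h2]
  exact Ideal.mul_mem_left _ _ (Ideal.mem_of_dvd _ h1 (qm_pow_sub_one_mem p n))

/-- `q ^ β` for `β ∈ ℤ_p`: the limit in `ℤ_{q,p}` of `q ^ β_n`, where the natural numbers `β_n` are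
the truncations of the `p`-adic expansion of `β`. -/
def qPow (β : ℤ_[p]) : Zqp p :=
  AdicCompletion.mk (maxIdeal p) (Zqm p)
    (AdicCompletion.AdicCauchySequence.mk (maxIdeal p) (Zqm p) (fun n => qm p ^ β.appr n)
      (by
        intro n
        rw [SModEq.sub_mem]
        simpa using qm_pow_sub_pow_mem p (β.appr_mono n.le_succ)
          (β.dvd_appr_sub_appr n (n + 1) n.le_succ)))

/-! ### The ring `E_{ℤ,q,p}` -/

open PowerSeries in
/-- The localization `ℤ_{q,p}[z]_S` at the set `S` of all polynomials `Q` with `|Q(0)| = 1`, as a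
subset of `ℤ_{q,p}⟦z⟧`: the power series `f` with `f Q = P` for polynomials `P`, `Q`, `Q ∈ S`. -/
def ratS : Set (Zqp p)⟦X⟧ :=
  {f | ∃ P Q : (Zqp p)[X], mNorm p (Q.coeff 0) = 1 ∧ f * (Q : (Zqp p)⟦X⟧) = (P : (Zqp p)⟦X⟧)}

/-- The Gauss norm on `ℤ_{q,p}⟦z⟧`: the supremum of the norms of the coefficients. -/
def gNorm (f : PowerSeries (Zqp p)) : ℝ := PowerSeries.gaussNorm (mNorm p) 1 f

theorem mNorm_bddBelow (x : Zqp p) :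
    BddBelow (Set.range fun n : {n : ℕ // red p n x = 0} => ((p : ℝ) ^ (n : ℕ))⁻¹) :=
  ⟨0, by rintro _ ⟨n, rfl⟩; positivity⟩

theorem red_zero_eq (x : Zqp p) : red p 0 x = 0 :=
  Ideal.Quotient.eq_zero_iff_mem.mpr (by simp) |> fun (h : Ideal.Quotient.mk (maxIdeal p ^ 0) 1 = 0)
    => by
      have h1 : (1 : Zqm p ⧸ maxIdeal p ^ 0) = 0 := h
      rw [← mul_one (red p 0 x), h1, mul_zero]

theorem mNorm_le {x : Zqp p} {n : ℕ} (h : red p n x = 0) : mNorm p x ≤ ((p : ℝ) ^ n)⁻¹ :=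
  ciInf_le (mNorm_bddBelow p x) ⟨n, h⟩

theorem mNorm_nonneg (x : Zqp p) : 0 ≤ mNorm p x :=
  Real.iInf_nonneg fun _ => by positivity

theorem mNorm_le_one (x : Zqp p) : mNorm p x ≤ 1 := by
  simpa using mNorm_le p (red_zero_eq p x)

theorem red_eq_zero_of_le {m n : ℕ} (hmn : m ≤ n) {x : Zqp p} (h : red p n x = 0) :
    red p m x = 0 := by
  obtain ⟨y, rfl⟩ := AdicCompletion.mk_surjective _ _ x
  have h1 := Ideal.Quotient.eq.mp (AdicCompletion.Ideal.mk_eq_mk (maxIdeal p) hmn y)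
  simp only [RingHom.coe_coe, AdicCompletion.evalₐ_mk] at h ⊢
  rw [Ideal.Quotient.eq_zero_iff_mem] at h ⊢
  have h2 := Ideal.sub_mem _ (Ideal.pow_le_pow_right hmn h) h1
  simpa using h2

theorem red_eq_zero_of_mNorm_lt {x : Zqp p} {n : ℕ} (h : mNorm p x < ((p : ℝ) ^ n)⁻¹) :
    red p n x = 0 := by
  have : Nonempty {n : ℕ // red p n x = 0} := ⟨⟨0, red_zero_eq p x⟩⟩
  obtain ⟨⟨k, hk⟩, hlt⟩ := exists_lt_of_ciInf_lt h
  have hp : (1 : ℝ) < p := by exact_mod_cast (Fact.out : p.Prime).one_lt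
  have : n < k := by
    by_contra hcon
    have := inv_anti₀ (by positivity) (pow_le_pow_right₀ hp.le (not_lt.mp hcon))
    exact absurd hlt (not_lt.mpr this)
  exact red_eq_zero_of_le p this.le hk

theorem mNorm_eq_one_iff (x : Zqp p) : mNorm p x = 1 ↔ red p 1 x ≠ 0 := by
  have hp : (1 : ℝ) < p := by exact_mod_cast (Fact.out : p.Prime).one_lt
  constructor
  · intro h h0
    have h1 := mNorm_le p h0
    rw [h, pow_one] at h1
    exact absurd h1 (not_le.mpr (inv_lt_one_of_one_lt₀ hp))
  · intro h
    refine le_antisymm (mNorm_le_one p x) ?_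
    have : Nonempty {n : ℕ // red p n x = 0} := ⟨⟨0, red_zero_eq p x⟩⟩
    refine le_ciInf ?_
    rintro ⟨n, hn⟩
    obtain rfl : n = 0 := by
      by_contra h0
      exact h (red_eq_zero_of_le p (Nat.one_le_iff_ne_zero.mpr h0) hn)
    simp

theorem gNorm_eq (f : PowerSeries (Zqp p)) : gNorm p f = ⨆ i, mNorm p (PowerSeries.coeff i f) := by
  simp [gNorm, PowerSeries.gaussNorm_eq]

theorem mNorm_coeff_le (f : PowerSeries (Zqp p)) (i : ℕ) :
    mNorm p (PowerSeries.coeff i f) ≤ gNorm p f := by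
  rw [gNorm_eq]
  exact le_ciSup (f := fun i => mNorm p (PowerSeries.coeff i f))
    ⟨1, by rintro _ ⟨i, rfl⟩; exact mNorm_le_one p _⟩ i

/-- Approximability in the Gauss norm, expressed through congruences. -/
theorem approx_iff (f : PowerSeries (Zqp p)) :
    (∀ ε > 0, ∃ g ∈ ratS p, gNorm p (f - g) < ε) ↔
      ∀ n, ∃ g ∈ ratS p, PowerSeries.map (red p n) f = PowerSeries.map (red p n) g := by
  have hp : (1 : ℝ) < p := by exact_mod_cast (Fact.out : p.Prime).one_lt
  constructor
  · intro h n
    obtain ⟨g, hg, hlt⟩ := h ((p : ℝ) ^ n)⁻¹ (by positivity)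
    refine ⟨g, hg, ?_⟩
    rw [← sub_eq_zero, ← map_sub]
    ext i
    simpa using red_eq_zero_of_mNorm_lt p ((mNorm_coeff_le p _ i).trans_lt hlt)
  · intro h ε hε
    obtain ⟨n, hn⟩ := exists_pow_lt_of_lt_one hε (inv_lt_one_of_one_lt₀ hp)
    obtain ⟨g, hg, heq⟩ := h n
    refine ⟨g, hg, lt_of_le_of_lt ?_ hn⟩
    rw [gNorm_eq]
    refine ciSup_le fun i => ?_
    rw [inv_pow]
    refine mNorm_le p ?_
    have := congrArg (PowerSeries.coeff i) heq
    simp only [PowerSeries.coeff_map] at this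
    rw [map_sub, map_sub, this, sub_self]

theorem maxIdeal_pow_one_isPrime : (maxIdeal p ^ 1).IsPrime := by
  rw [pow_one]; infer_instance

theorem mNorm_mul_eq_one {x y : Zqp p} (hx : mNorm p x = 1) (hy : mNorm p y = 1) :
    mNorm p (x * y) = 1 := by
  have := maxIdeal_pow_one_isPrime p
  rw [mNorm_eq_one_iff] at *
  rw [map_mul]
  exact mul_ne_zero hx hy

theorem mNorm_one : mNorm p 1 = 1 := by
  have := maxIdeal_pow_one_isPrime p
  rw [mNorm_eq_one_iff, map_one]
  exact one_ne_zero

theorem poly_mem_ratS (P : (Zqp p)[X]) : (P : PowerSeries (Zqp p)) ∈ ratS p :=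
  ⟨P, 1, by simpa using mNorm_one p, by simp⟩

theorem add_mem_ratS {f g : PowerSeries (Zqp p)} (hf : f ∈ ratS p) (hg : g ∈ ratS p) :
    f + g ∈ ratS p := by
  obtain ⟨P, Q, hQ, h⟩ := hf
  obtain ⟨P', Q', hQ', h'⟩ := hg
  refine ⟨P * Q' + P' * Q, Q * Q', ?_, ?_⟩
  · rw [mul_coeff_zero]; exact mNorm_mul_eq_one p hQ hQ'
  · push_cast
    rw [← h, ← h']; ring

theorem mul_mem_ratS {f g : PowerSeries (Zqp p)} (hf : f ∈ ratS p) (hg : g ∈ ratS p) :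
    f * g ∈ ratS p := by
  obtain ⟨P, Q, hQ, h⟩ := hf
  obtain ⟨P', Q', hQ', h'⟩ := hg
  refine ⟨P * P', Q * Q', ?_, ?_⟩
  · rw [mul_coeff_zero]; exact mNorm_mul_eq_one p hQ hQ'
  · push_cast
    rw [← h, ← h']; ring

/-- The ring `E_{ℤ,q,p}`: the completion of `ℤ_{q,p}[z]_S` for the Gauss norm, realized as the
closure of `ℤ_{q,p}[z]_S` in the complete ring `ℤ_{q,p}⟦z⟧`. -/
def E : Subring (PowerSeries (Zqp p)) where
  carrier := {f | ∀ ε > 0, ∃ g ∈ ratS p, gNorm p (f - g) < ε}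
  mul_mem' := by
    intro a b ha hb
    simp only [Set.mem_ofPred_eq, approx_iff] at *
    intro n
    obtain ⟨g, hg, h⟩ := ha n
    obtain ⟨g', hg', h'⟩ := hb n
    exact ⟨g * g', mul_mem_ratS p hg hg', by rw [map_mul, map_mul, h, h']⟩
  one_mem' := by
    simp only [Set.mem_ofPred_eq, approx_iff]
    exact fun n => ⟨1, by simpa using poly_mem_ratS p 1, rfl⟩
  add_mem' := by
    intro a b ha hb
    simp only [Set.mem_ofPred_eq, approx_iff] at *
    intro n
    obtain ⟨g, hg, h⟩ := ha n
    obtain ⟨g', hg', h'⟩ := hb n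
    exact ⟨g + g', add_mem_ratS p hg hg', by rw [map_add, map_add, h, h']⟩
  zero_mem' := by
    simp only [Set.mem_ofPred_eq, approx_iff]
    exact fun n => ⟨0, by simpa using poly_mem_ratS p 0, rfl⟩
  neg_mem' := by
    intro a ha
    simp only [Set.mem_ofPred_eq, approx_iff] at *
    intro n
    obtain ⟨g, hg, h⟩ := ha n
    refine ⟨-g, ?_, by rw [map_neg, map_neg, h]⟩
    have := mul_mem_ratS p (poly_mem_ratS p (-1)) hg
    simpa using this

theorem mem_E_iff (f : PowerSeries (Zqp p)) :
    f ∈ E p ↔ ∀ n, ∃ g ∈ ratS p, PowerSeries.map (red p n) f = PowerSeries.map (red p n) g :=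
  approx_iff p f

theorem ratS_subset_E {f : PowerSeries (Zqp p)} (hf : f ∈ ratS p) : f ∈ E p :=
  (mem_E_iff p f).mpr fun _ => ⟨f, hf, rfl⟩

/-! ### The endomorphisms `σ_q` and `𝐅_q` -/

/-- `σ_q (∑ aₙ zⁿ) = ∑ aₙ qⁿ zⁿ` on `ℤ_{q,p}⟦z⟧`. -/
def sigmaPS : PowerSeries (Zqp p) →+* PowerSeries (Zqp p) := PowerSeries.rescale (q p)

/-- `𝐅_q (∑ aₙ zⁿ) = ∑ 𝐅_q(aₙ) z^{np}` on `ℤ_{q,p}⟦z⟧`. -/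
def frobPS : PowerSeries (Zqp p) →+* PowerSeries (Zqp p) :=
  (PowerSeries.expand (R := Zqp p) p (Fact.out : p.Prime).ne_zero).toRingHom.comp
    (PowerSeries.map (frob p))

theorem mNorm_frob_eq_one {x : Zqp p} (hx : mNorm p x = 1) : mNorm p (frob p x) = 1 := by
  rw [mNorm_eq_one_iff] at *
  rw [red_frob]
  intro h
  apply hx
  obtain ⟨y, hy⟩ := Ideal.Quotient.mk_surjective (red p 1 x)
  rw [← hy] at h ⊢
  rw [frobMod, Ideal.quotientMap_mk, Ideal.Quotient.eq_zero_iff_mem, pow_one] at h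
  rw [Ideal.Quotient.eq_zero_iff_mem, pow_one]
  have hl : IsLocalHom (frobZqm p) :=
    Localization.isLocalHom_localRingHom _ _ _ (mIdeal_eq_comap_expand p)
  rw [IsLocalRing.mem_maximalIdeal, mem_nonunits_iff] at h ⊢
  exact fun hy => h (hy.map _)

theorem sigmaPS_mem_ratS {f : PowerSeries (Zqp p)} (hf : f ∈ ratS p) : sigmaPS p f ∈ ratS p := by
  obtain ⟨P, Q, hQ, h⟩ := hf
  have key (P : (Zqp p)[X]) : ((P.comp (C (q p) * X) : (Zqp p)[X]) : PowerSeries (Zqp p)) =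
      sigmaPS p P := by
    ext n
    rw [Polynomial.coeff_coe, comp_C_mul_X_coeff, sigmaPS, PowerSeries.coeff_rescale,
      Polynomial.coeff_coe, mul_comm]
  refine ⟨P.comp (C (q p) * X), Q.comp (C (q p) * X), ?_, ?_⟩
  · rwa [comp_C_mul_X_coeff, pow_zero, mul_one]
  · rw [key, key, ← map_mul, h]

theorem frobPS_mem_ratS {f : PowerSeries (Zqp p)} (hf : f ∈ ratS p) : frobPS p f ∈ ratS p := by
  obtain ⟨P, Q, hQ, h⟩ := hf
  have hp : 0 < p := (Fact.out : p.Prime).pos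
  have key (P : (Zqp p)[X]) :
      ((Polynomial.expand _ p (P.map (frob p)) : (Zqp p)[X]) : PowerSeries (Zqp p)) =
      frobPS p P := by
    ext n
    rw [Polynomial.coeff_coe, Polynomial.coeff_expand hp]
    simp only [frobPS, RingHom.comp_apply, AlgHom.toRingHom_eq_coe, RingHom.coe_coe,
      PowerSeries.coeff_expand, PowerSeries.coeff_map, Polynomial.coeff_map, Polynomial.coeff_coe]
  refine ⟨Polynomial.expand _ p (P.map (frob p)), Polynomial.expand _ p (Q.map (frob p)), ?_, ?_⟩
  · rw [Polynomial.coeff_expand hp]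
    simpa using mNorm_frob_eq_one p hQ
  · rw [key, key, ← map_mul, h]

theorem sigmaPS_mem_E (f : PowerSeries (Zqp p)) (hf : f ∈ E p) : sigmaPS p f ∈ E p := by
  rw [mem_E_iff] at *
  intro n
  obtain ⟨g, hg, h⟩ := hf n
  refine ⟨sigmaPS p g, sigmaPS_mem_ratS p hg, ?_⟩
  ext i
  have := congrArg (PowerSeries.coeff i) h
  simp only [PowerSeries.coeff_map] at this
  simp only [sigmaPS, PowerSeries.coeff_map, PowerSeries.coeff_rescale, map_mul, this]

theorem frobPS_mem_E (f : PowerSeries (Zqp p)) (hf : f ∈ E p) : frobPS p f ∈ E p := by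
  rw [mem_E_iff] at *
  intro n
  obtain ⟨g, hg, h⟩ := hf n
  refine ⟨frobPS p g, frobPS_mem_ratS p hg, ?_⟩
  ext i
  have := congrArg (PowerSeries.coeff (i / p)) h
  simp only [PowerSeries.coeff_map] at this
  simp only [frobPS, PowerSeries.coeff_map, RingHom.comp_apply, AlgHom.toRingHom_eq_coe,
    RingHom.coe_coe (PowerSeries.expand (R := Zqp p) p _), PowerSeries.coeff_expand]
  split_ifs
  · rw [red_frob, red_frob, this]
  · rfl

/-- The endomorphism `σ_q` of `E_{ℤ,q,p}`. -/
def sigmaE : E p →+* E p := (sigmaPS p).restrict (E p) (E p) (sigmaPS_mem_E p)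

/-- The Frobenius endomorphism `𝐅_q` of `E_{ℤ,q,p}`. -/
def frobE : E p →+* E p := (frobPS p).restrict (E p) (E p) (frobPS_mem_E p)

/-! ### `q`-difference operators and strong Frobenius structures -/

/-- A monic `q`-difference operator `σ_qⁿ + a₁ σ_qⁿ⁻¹ + ⋯ + aₙ` of order `n` with coefficients in
`E_{ℤ,q,p}`; `L.a i` is the coefficient `a_{i+1}` of `σ_q^{n-1-i}`. -/
@[ext]
structure QDiffOp (n : ℕ) where
  /-- The coefficients `a₁, …, aₙ`. -/
  a : Fin n → E p

variable {p}

/-- The companion matrix of `L`: ones above the diagonal, last row `(-aₙ, …, -a₁)`, and zeros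
elsewhere. -/
def QDiffOp.companion {n : ℕ} (L : QDiffOp p n) : Matrix (Fin n) (Fin n) (E p) :=
  Matrix.of fun i j =>
    if (i : ℕ) + 1 = n then -L.a j.rev else if (j : ℕ) = (i : ℕ) + 1 then 1 else 0

/-- `H` is a Frobenius transition matrix of period `h` for `L`: `H` is invertible over `E_{ℤ,q,p}`
and `σ_q(H) A^{𝐅_q^h} = A H`, where `A` is the companion matrix of `L`. -/
def QDiffOp.IsFrobeniusTransition {n : ℕ} (L : QDiffOp p n) (h : ℕ)
    (H : Matrix (Fin n) (Fin n) (E p)) : Prop :=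
  IsUnit H ∧ H.map (sigmaE p) * L.companion.map ((frobE p)^[h]) = L.companion * H

/-- `L` has a strong Frobenius structure (for `p`) with period `h`. -/
def QDiffOp.HasStrongFrobeniusStructure {n : ℕ} (L : QDiffOp p n) (h : ℕ) : Prop :=
  0 < h ∧ ∃ H : Matrix (Fin n) (Fin n) (E p), L.IsFrobeniusTransition h H

/-! ### The order-one `q`-hypergeometric operator -/

/-- A rational number `α = a / b` with `p ≡ 1 mod b` is a `p`-adic integer. -/
theorem norm_ratCast_le_one {α : ℚ} {a : ℤ} {b : ℕ} (hα : α = a / b) (hp : p ≡ 1 [MOD b]) :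
    ‖(α : ℚ_[p])‖ ≤ 1 := by
  have hpb : ¬ p ∣ b := by
    intro h
    have h1 : p ≡ 1 [MOD p] := hp.of_dvd h
    have h2 := (Nat.modEq_zero_iff_dvd.mpr dvd_rfl).symm.trans h1
    exact (Fact.out : p.Prime).one_lt.ne' (Nat.dvd_one.mp (Nat.modEq_zero_iff_dvd.mp h2.symm))
  have hb : ‖(b : ℚ_[p])‖ = 1 := by
    refine le_antisymm (by simpa using Padic.norm_int_le_one (p := p) (b : ℤ)) ?_
    by_contra hlt
    have := (Padic.norm_intCast_lt_one_iff (p := p) (k := (b : ℤ))).mp (by simpa using not_le.mp hlt)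
    exact hpb (by exact_mod_cast this)
  rw [hα]
  push_cast
  rw [norm_div, hb, div_one]
  exact Padic.norm_int_le_one a

/-- The power series `(1 - z) / (1 - q ^ β z)`. -/
def hypSeries (β : ℤ_[p]) : PowerSeries (Zqp p) :=
  (1 - PowerSeries.X) *
    PowerSeries.invOfUnit (1 - PowerSeries.C (qPow p β) * PowerSeries.X) 1

theorem hypSeries_mul (β : ℤ_[p]) :
    hypSeries β * (1 - PowerSeries.C (qPow p β) * PowerSeries.X) = 1 - PowerSeries.X := by
  rw [hypSeries, mul_assoc, PowerSeries.invOfUnit_mul _ _ (by simp), mul_one]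

theorem hypSeries_mem_E (β : ℤ_[p]) : hypSeries β ∈ E p := by
  refine ratS_subset_E p ⟨1 - X, 1 - C (qPow p β) * X, by simpa using mNorm_one p, ?_⟩
  simpa using hypSeries_mul β

/-- The order-one `q`-hypergeometric operator `σ_q - (1 - z) / (1 - q ^ β z)`. -/
def hypOp (β : ℤ_[p]) : QDiffOp p 1 where
  a := fun _ => -⟨hypSeries β, hypSeries_mem_E β⟩

/-- The `q`-Pochhammer symbol `(x; q)_n = (1 - x) (1 - x q) ⋯ (1 - x q ^ (n - 1))`. -/
def qPochhammer (x : Zqp p) (n : ℕ) : Zqp p := ∏ k ∈ Finset.range n, (1 - x * q p ^ k)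

/-- `f = ∑ (q ^ β; q)_n / (q; q)_n zⁿ`, the division being carried out in `ℤ_{q,p}`. -/
def IsQHypSeries (β : ℤ_[p]) (f : PowerSeries (Zqp p)) : Prop :=
  ∀ n, PowerSeries.coeff n f * qPochhammer (q p) n = qPochhammer (qPow p β) n

end

end QFrob

/-! Write `p = 1 + b c` and `s = (b - a) c ≥ 0`. Then `α = 1 + s / (1 - p)` is the `p`-adic limit of
the integers `m_k = 1 + s (1 + p + ⋯ + p ^ (k - 1))`. For a natural exponent `m` the `q`-binomial
theorem reads `f_m = 1 / (z; q)_m`, which suggests approximating `f_α / 𝐅_q(f_α)` by `R_k = (z ^ p;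
q ^ p)_{m_k} / (z; q)_{m_{k + 1}}`.

The `R_k` converge for the Gauss norm. At each `p ^ (k + 1)`-th root of unity `q ≠ 1`, `(z; q)_{p ^
(k + 1)}` equals `(z ^ p; q ^ p)_{p ^ k}`, so over `ℤ[q]` their difference is divisible by `[p ^ (k
+ 1)]_q`, an element of `𝔪 ^ (k + 1)` (`geom_sum_dvd_qProd_sub_expand`,
`geom_sum_mem_maxIdeal_pow`). As also `q ^ p ^ k ≡ 1` modulo `𝔪 ^ k`, this gives `R_k ≡ R_{k + 1}`
modulo `𝔪 ^ k` (`map_transApprox_succ`). The limit `H` is a unit of `E p`. Each `R_k` satisfies an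
explicit first-order `q`-difference equation, and the limit of these is `σ_q(H) 𝐅_q(A) = A H` with
`A = (1 - z) / (1 - q ^ α z)` (`sigmaPS_transition`).

The series `f_α` is then recovered from `H`. The product `f = H 𝐅_q(H) 𝐅_q²(H) ⋯` solves `f = H
𝐅_q(f)`, and `σ_q(f) / (A f)` is fixed by `𝐅_q` with constant term `1`, hence is `1`
(`sigmaPS_eq_mul`). So `σ_q(f) = A f`, whose coefficient recursion is that of `f_α`. Integrality of
the coefficients thus comes for free; their uniqueness holds because `1 - q ^ n` is regular in
`ℤ_{q,p}`. -/

namespace QFrob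

open Polynomial

noncomputable section

/-! ### The polynomials `(z; t)_N` -/

/-- The polynomial `(z; t)_N = (1 - z) (1 - t z) ⋯ (1 - t ^ (N - 1) z)` in `z`. -/
def qProd {S : Type*} [CommRing S] (t : S) (N : ℕ) : S[X] :=
  ∏ i ∈ Finset.range N, (1 - C (t ^ i) * X)

section

variable {S T : Type*} [CommRing S] [CommRing T]

theorem map_qProd (f : S →+* T) (t : S) (N : ℕ) : (qProd t N).map f = qProd (f t) N := by
  simp [qProd, Polynomial.map_prod]

theorem qProd_add (t : S) (M N : ℕ) :
    qProd t (M + N) = qProd t M * (qProd t N).comp (C (t ^ M) * X) := by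
  rw [qProd, Finset.prod_range_add, qProd, qProd, prod_comp]
  congr 1
  refine Finset.prod_congr rfl fun i _ => ?_
  simp only [sub_comp, one_comp, mul_comp, C_comp, X_comp, pow_add, C_mul]
  ring

theorem qProd_mul_of_pow_eq_one {t : S} {m : ℕ} (ht : t ^ m = 1) (s : ℕ) :
    qProd t (s * m) = qProd t m ^ s := by
  induction s with
  | zero => simp [qProd]
  | succ s ih =>
    rw [add_mul, one_mul, qProd_add, ih, mul_comm s m, pow_mul, ht, one_pow]
    simp [pow_succ]

theorem coeff_zero_qProd (t : S) (N : ℕ) : (qProd t N).coeff 0 = 1 := by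
  simp [qProd, coeff_zero_eq_eval_zero, eval_prod]

/-- This is the factorization of `x ^ n - y ^ n` over the `n`-th roots of unity, taken in `S[X]`
with `x = 1`, `y = X`. -/
theorem qProd_of_isPrimitiveRoot [IsDomain S] {t : S} {n : ℕ} (ht : IsPrimitiveRoot t n)
    (hn : 0 < n) : qProd t n = 1 - X ^ n := by
  classical
  have hC : IsPrimitiveRoot (C t) n := ht.map_of_injective C_injective
  have himg : (Finset.range n).image (fun i => C t ^ i) = nthRootsFinset n (1 : S[X]) := by
    apply Finset.eq_of_subset_of_card_le
    · intro x hx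
      obtain ⟨i, -, rfl⟩ := Finset.mem_image.mp hx
      rw [mem_nthRootsFinset hn, ← pow_mul, mul_comm, pow_mul, hC.pow_eq_one, one_pow]
    · rw [Finset.card_image_of_injOn, hC.card_nthRootsFinset, Finset.card_range]
      intro i hi j hj h
      exact hC.pow_inj (by simpa using hi) (by simpa using hj) h
  have h := hC.pow_sub_pow_eq_prod_sub_mul 1 X hn
  rw [one_pow, ← himg, Finset.prod_image] at h
  · rw [h, qProd]
    simp
  · intro i hi j hj h
    exact hC.pow_inj (by simpa using hi) (by simpa using hj) h

/-- At a nontrivial root of unity `t` of order dividing `p ^ (k + 1)`, the polynomial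
`(z; t)_{p ^ (k + 1)}` only depends on `z ^ p`. -/
theorem qProd_prime_pow_of_pow_eq_one [IsDomain S] {p : ℕ} (hp : p.Prime) {k : ℕ} {t : S}
    (ht : t ^ p ^ (k + 1) = 1) (ht1 : t ≠ 1) :
    qProd t (p ^ (k + 1)) = expand S p (qProd (t ^ p) (p ^ k)) := by
  obtain ⟨j, hj, hord⟩ := (Nat.dvd_prime_pow hp).mp (orderOf_dvd_of_pow_eq_one ht)
  have hprim : IsPrimitiveRoot t (p ^ j) := hord ▸ IsPrimitiveRoot.orderOf t
  -- The case `j = 0` would force `t = 1`.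
  obtain _ | i := j
  · simp_all
  have hi : i ≤ k := by omega
  have hprim' : IsPrimitiveRoot (t ^ p) (p ^ i) :=
    hprim.pow (pow_pos hp.pos _) (pow_succ' p i)
  -- With `t` of order `p ^ (i + 1)` and `t ^ p` of order `p ^ i`, both sides become `(1 - z ^ p ^
  -- (i + 1)) ^ p ^ (k - i)`.
  have e1 : p ^ (k + 1) = p ^ (k - i) * p ^ (i + 1) := by rw [← pow_add]; congr 1; omega
  have e2 : p ^ k = p ^ (k - i) * p ^ i := by rw [← pow_add]; congr 1; omega
  rw [e1, e2, qProd_mul_of_pow_eq_one hprim.pow_eq_one, qProd_mul_of_pow_eq_one hprim'.pow_eq_one,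
    qProd_of_isPrimitiveRoot hprim (pow_pos hp.pos _),
    qProd_of_isPrimitiveRoot hprim' (pow_pos hp.pos _)]
  simp [← pow_mul, ← pow_succ']

end

/-! ### Divisibility by `q`-integers in `ℤ[q]` -/

theorem geom_sum_eq_prod_X_sub_C {N : ℕ} (hN : 0 < N) :
    ∑ i ∈ Finset.range N, (X : ℂ[X]) ^ i = ∏ ζ ∈ (nthRootsFinset N (1 : ℂ)).erase 1, (X - C ζ) := by
  have h1 : (1 : ℂ) ∈ nthRootsFinset N (1 : ℂ) := by rw [mem_nthRootsFinset hN, one_pow]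
  have h := X_pow_sub_one_eq_prod hN (Complex.isPrimitiveRoot_exp N hN.ne')
  rw [← Finset.mul_prod_erase _ _ h1, ← mul_geom_sum, C_1] at h
  exact mul_left_cancel₀ (X_sub_C_ne_zero (1 : ℂ)) (by simpa using h)

/-- The divisor is monic, so divisibility may be tested over `ℂ`, where it splits into distinct
linear factors. -/
theorem geom_sum_dvd_of_eval₂_eq_zero {N : ℕ} (hN : 0 < N) (c : ℤ[X])
    (h : ∀ ζ : ℂ, ζ ^ N = 1 → ζ ≠ 1 → eval₂ (Int.castRingHom ℂ) ζ c = 0) :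
    ∑ i ∈ Finset.range N, (X : ℤ[X]) ^ i ∣ c := by
  rw [← map_dvd_map (Int.castRingHom ℂ) Int.cast_injective (monic_geom_sum_X hN.ne'),
    Polynomial.map_sum]
  simp only [Polynomial.map_pow, map_X]
  rw [geom_sum_eq_prod_X_sub_C hN]
  refine Finset.prod_dvd_of_coprime
    (fun a _ b _ hab => pairwise_coprime_X_sub_C Function.injective_id hab) fun ζ hζ => ?_
  rw [Finset.mem_erase, mem_nthRootsFinset hN] at hζ
  rw [dvd_iff_isRoot, IsRoot, eval_map]
  exact h ζ hζ.2 hζ.1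

/-- The difference of `(z; q)_{p ^ (k + 1)}` and `(z ^ p; q ^ p)_{p ^ k}` is divisible by the
`q`-integer `[p ^ (k + 1)]_q`. -/
theorem geom_sum_dvd_qProd_sub_expand {p : ℕ} (hp : p.Prime) (k : ℕ) :
    C (∑ i ∈ Finset.range (p ^ (k + 1)), (X : ℤ[X]) ^ i) ∣
      qProd (X : ℤ[X]) (p ^ (k + 1)) - expand ℤ[X] p (qProd (X ^ p) (p ^ k)) := by
  -- Divisibility is tested on each coefficient in `z`, which is a polynomial in `q`.
  rw [C_dvd_iff_dvd_coeff]
  intro i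
  refine geom_sum_dvd_of_eval₂_eq_zero (pow_pos hp.pos _) _ fun ζ hζ hζ1 => ?_
  rw [← coe_eval₂RingHom, ← coeff_map, Polynomial.map_sub, map_expand, map_qProd, map_qProd]
  simp [qProd_prime_pow_of_pow_eq_one hp hζ hζ1]

/-! ### Identities for `(z; t)_N` over a commutative ring -/

section

variable {S : Type*} [CommRing S]

theorem expand_comp_C_pow_mul_X (p : ℕ) (a : S) (f : S[X]) :
    expand S p (f.comp (C (a ^ p) * X)) = (expand S p f).comp (C a * X) := by
  simp only [expand_eq_comp_X_pow, comp_assoc]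
  simp [mul_pow]

/-- Both sides are `(z; t)_{M + 1}`, with the first or the last factor split off. This computes the
effect of `z ↦ t z` without dividing. -/
theorem qProd_comp_mul (t : S) (M : ℕ) :
    (qProd t M).comp (C t * X) * (1 - X) = qProd t M * (1 - C (t ^ M) * X) := by
  have h1 := qProd_add t 1 M
  have h2 := qProd_add t M 1
  have h3 : qProd t 1 = 1 - X := by simp [qProd]
  rw [h3, pow_one] at h1
  rw [mul_comm, ← h1, add_comm, h2, h3]
  simp

theorem expand_qProd_comp_mul (p : ℕ) (t : S) (M : ℕ) :
    (expand S p (qProd (t ^ p) M)).comp (C t * X) * (1 - X ^ p) =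
      expand S p (qProd (t ^ p) M) * (1 - C ((t ^ M) ^ p) * X ^ p) := by
  have h := congrArg (expand S p) (qProd_comp_mul (t ^ p) M)
  rw [map_mul, map_mul, expand_comp_C_pow_mul_X] at h
  simpa [← pow_mul, mul_comm p M] using h

/-- The cross-multiplied form of `R_k = R_{k + 1}`. Splitting off the last `s p ^ k`, respectively
`s p ^ (k + 1)`, factors leaves an `s`-th power of the two sides of `h`, shifted by the same `t ^
m`. -/
theorem expand_qProd_mul_qProd {p k m s : ℕ} {t : S} (ht : t ^ p ^ k = 1)
    (h : qProd t (p ^ (k + 1)) = expand S p (qProd (t ^ p) (p ^ k))) :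
    expand S p (qProd (t ^ p) (m + s * p ^ k)) * qProd t (m + s * p ^ k) =
      expand S p (qProd (t ^ p) m) * qProd t (m + s * p ^ k + s * p ^ (k + 1)) := by
  have ht' : (t ^ p) ^ p ^ k = 1 := by rw [pow_right_comm, ht, one_pow]
  have ht'' : t ^ p ^ (k + 1) = 1 := by rw [pow_succ, pow_mul, ht, one_pow]
  have e : t ^ (m + s * p ^ k) = t ^ m := by rw [pow_add, mul_comm s, pow_mul, ht]; simp
  rw [qProd_add (t ^ p), qProd_add t (m + s * p ^ k) (s * p ^ (k + 1)), e,
    qProd_mul_of_pow_eq_one ht', qProd_mul_of_pow_eq_one ht'', h, map_mul, pow_right_comm,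
    expand_comp_C_pow_mul_X, map_pow]
  ring

theorem coe_comp_C_mul_X (t : S) (f : S[X]) :
    ((f.comp (C t * X) : S[X]) : PowerSeries S) = PowerSeries.rescale t f := by
  ext n
  rw [Polynomial.coeff_coe, comp_C_mul_X_coeff, PowerSeries.coeff_rescale, Polynomial.coeff_coe,
    mul_comm]

theorem map_coe_qProd {T : Type*} [CommRing T] (f : S →+* T) (t : S) (N : ℕ) :
    PowerSeries.map f (qProd t N : S[X]) = (qProd (f t) N : T[X]) := by
  rw [← Polynomial.polynomial_map_coe, map_qProd]

theorem map_coe_expand_qProd {T : Type*} [CommRing T] (f : S →+* T) (p : ℕ) (t : S) (N : ℕ) :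
    PowerSeries.map f (expand S p (qProd t N) : S[X]) = (expand T p (qProd (f t) N) : T[X]) := by
  rw [← Polynomial.polynomial_map_coe, Polynomial.map_expand, map_qProd]

theorem qProd_prime_pow_of_map_geom_sum_eq_zero {p : ℕ} (hp : p.Prime) {k : ℕ} (φ : ℤ[X] →+* S)
    (h : φ (∑ i ∈ Finset.range (p ^ (k + 1)), X ^ i) = 0) :
    qProd (φ X) (p ^ (k + 1)) = expand S p (qProd (φ X ^ p) (p ^ k)) := by
  have h1 := Polynomial.map_dvd φ (geom_sum_dvd_qProd_sub_expand hp k)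
  rw [map_C, h, C_0, zero_dvd_iff, Polynomial.map_sub, Polynomial.map_expand, map_qProd, map_qProd,
    map_pow] at h1
  exact sub_eq_zero.mp h1

theorem isUnit_of_constantCoeff_eq_one {f : PowerSeries S}
    (h : PowerSeries.constantCoeff f = 1) : IsUnit f := by
  rw [PowerSeries.isUnit_iff_constantCoeff, h]
  exact isUnit_one

theorem isUnit_coe_of_coeff_zero_eq_one {f : S[X]} (h : f.coeff 0 = 1) :
    IsUnit (f : PowerSeries S) :=
  isUnit_of_constantCoeff_eq_one (by simpa using h)

end

section

variable (p : ℕ)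

/-- The `p`-adic truncations `1 + s (1 + p + ⋯ + p ^ (k - 1))` of `1 + s / (1 - p)`. -/
def truncExp (s k : ℕ) : ℕ := 1 + s * ∑ i ∈ Finset.range k, p ^ i

theorem truncExp_succ (s k : ℕ) : truncExp p s (k + 1) = truncExp p s k + s * p ^ k := by
  rw [truncExp, truncExp, Finset.sum_range_succ]; ring

variable [Fact p.Prime]

/-! ### Reduction modulo `𝔪 ^ n` -/

/-- `[p ^ (k + 1)]_q = [p ^ k]_q · [p]_{q ^ p ^ k}`, and the last factor lies in `𝔪` because its
value at `q = 1` is `p`. -/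
theorem geom_sum_mem_maxIdeal_pow (k : ℕ) :
    algebraMap ℤ[X] (Zqm p) (∑ i ∈ Finset.range (p ^ k), X ^ i) ∈ maxIdeal p ^ k := by
  induction k with
  | zero => simp
  | succ k ih =>
    have h : ∑ i ∈ Finset.range (p ^ (k + 1)), (X : ℤ[X]) ^ i =
        (∑ i ∈ Finset.range (p ^ k), X ^ i) * ∑ i ∈ Finset.range p, (X ^ p ^ k) ^ i := by
      apply mul_left_cancel₀ (X_sub_C_ne_zero (1 : ℤ))
      rw [C_1, ← mul_assoc, mul_geom_sum, mul_geom_sum, mul_geom_sum, ← pow_mul, pow_succ]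
    rw [h, map_mul, pow_succ]
    refine Ideal.mul_mem_mul ih (algebraMap_mem_maxIdeal p ?_)
    simp [mIdeal_eq_ker, RingHom.mem_ker]

/-- The ring `ℤ[q]_𝔪 / 𝔪 ^ n`, as a type of its own with a single ring structure. -/
def ZqmMod (n : ℕ) : Type := Zqm p ⧸ maxIdeal p ^ n

instance (n : ℕ) : CommRing (ZqmMod p n) := Ideal.Quotient.commRing (maxIdeal p ^ n)

/-- The projection `ℤ[q]_𝔪 → ℤ[q]_𝔪 / 𝔪 ^ n`. -/
def toMod (n : ℕ) : Zqm p →+* ZqmMod p n := Ideal.Quotient.mk (maxIdeal p ^ n)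

/-- The projection `ℤ_{q,p} → ℤ[q]_𝔪 / 𝔪 ^ n`. -/
def redMod (n : ℕ) : Zqp p →+* ZqmMod p n := red p n

theorem toMod_eq_iff {n : ℕ} {x y : Zqm p} :
    toMod p n x = toMod p n y ↔ x - y ∈ maxIdeal p ^ n :=
  Ideal.Quotient.eq

theorem redMod_algebraMap (n : ℕ) (x : Zqm p) :
    redMod p n (algebraMap (Zqm p) (Zqp p) x) = toMod p n x :=
  (AdicCompletion.evalₐ (maxIdeal p) n).commutes x

theorem redMod_mk (n : ℕ) (x : AdicCompletion.AdicCauchySequence (maxIdeal p) (Zqm p)) :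
    redMod p n (AdicCompletion.mk (maxIdeal p) (Zqm p) x) = toMod p n (x n) :=
  AdicCompletion.evalₐ_mk (maxIdeal p) n x

theorem ext_redMod {x y : Zqp p} (h : ∀ n, redMod p n x = redMod p n y) : x = y :=
  AdicCompletion.ext_evalₐ h

/-- The image of `q` in `ℤ[q]_𝔪 / 𝔪 ^ n`. -/
def qBar (n : ℕ) : ZqmMod p n := toMod p n (qm p)

theorem redMod_q (n : ℕ) : redMod p n (q p) = qBar p n :=
  AdicCompletion.evalₐ_of (maxIdeal p) n (qm p)

theorem redMod_frob_of_eq_pow {n m : ℕ} {x : Zqp p} (h : redMod p n x = qBar p n ^ m) :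
    redMod p n (frob p x) = (qBar p n ^ m) ^ p := by
  have h1 : redMod p n (frob p x) = frobMod p n (redMod p n x) := red_frob p n x
  have h2 (y : Zqm p) : frobMod p n (toMod p n y) = toMod p n (frobZqm p y) :=
    Ideal.quotientMap_mk
  have h3 : frobZqm p (qm p) = qm p ^ p := by
    rw [frobZqm, qm, Localization.localRingHom_to_map, RingHom.coe_coe, expand_X, map_pow]
  rw [h1, h, qBar, ← map_pow, h2, map_pow, h3, ← map_pow, pow_right_comm]

theorem qBar_pow_prime_pow {n k : ℕ} (h : n ≤ k) : qBar p n ^ p ^ k = 1 := by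
  rw [qBar, ← map_pow, ← map_one (toMod p n), toMod_eq_iff]
  exact Ideal.pow_le_pow_right h (qm_pow_sub_one_mem p k)

theorem qProd_qBar_prime_pow {n k : ℕ} (h : n ≤ k + 1) :
    qProd (qBar p n) (p ^ (k + 1)) = expand _ p (qProd (qBar p n ^ p) (p ^ k)) := by
  refine qProd_prime_pow_of_map_geom_sum_eq_zero Fact.out
    ((toMod p n).comp (algebraMap ℤ[X] (Zqm p))) ?_
  rw [RingHom.comp_apply, ← map_zero (toMod p n), toMod_eq_iff, sub_zero]
  exact Ideal.pow_le_pow_right h (geom_sum_mem_maxIdeal_pow p (k + 1))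

/-- The rational function `(z ^ p; q ^ p)_{m_k} / (z; q)_{m_{k + 1}}` with `m_k = truncExp p s k`. -/
def transApprox (s k : ℕ) : PowerSeries (Zqm p) :=
  ((expand _ p (qProd (qm p ^ p) (truncExp p s k)) : (Zqm p)[X]) : PowerSeries (Zqm p)) *
    PowerSeries.invOfUnit ((qProd (qm p) (truncExp p s (k + 1)) : (Zqm p)[X]) :
      PowerSeries (Zqm p)) 1

theorem transApprox_mul (s k : ℕ) :
    transApprox p s k * (qProd (qm p) (truncExp p s (k + 1)) : (Zqm p)[X]) =
      (expand _ p (qProd (qm p ^ p) (truncExp p s k)) : (Zqm p)[X]) := by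
  rw [transApprox, mul_assoc, PowerSeries.invOfUnit_mul, mul_one]
  simpa using coeff_zero_qProd (qm p) _

theorem coeff_zero_expand_qProd {S : Type*} [CommRing S] (t : S) (N : ℕ) :
    (expand S p (qProd t N)).coeff 0 = 1 := by
  rw [Polynomial.coeff_expand (Fact.out : p.Prime).pos]
  simp [coeff_zero_qProd]

theorem map_transApprox_mul (s k n : ℕ) :
    PowerSeries.map (toMod p n) (transApprox p s k) *
        (qProd (qBar p n) (truncExp p s (k + 1)) : (ZqmMod p n)[X]) =
      (expand _ p (qProd (qBar p n ^ p) (truncExp p s k)) : (ZqmMod p n)[X]) := by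
  have h := congrArg (PowerSeries.map (toMod p n)) (transApprox_mul p s k)
  rw [map_mul, map_coe_qProd, map_coe_expand_qProd, map_pow] at h
  exact h

/-- The Cauchy property of the approximations, uniformly in the coefficients. -/
theorem map_transApprox_succ (s : ℕ) {n k : ℕ} (h : n ≤ k) :
    PowerSeries.map (toMod p n) (transApprox p s k) =
      PowerSeries.map (toMod p n) (transApprox p s (k + 1)) := by
  have h1 := map_transApprox_mul p s k n
  have h2 := map_transApprox_mul p s (k + 1) n
  have h3 := expand_qProd_mul_qProd (m := truncExp p s k) (s := s) (qBar_pow_prime_pow p h)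
    (qProd_qBar_prime_pow p (n := n) (k := k) (by omega))
  rw [← truncExp_succ, ← truncExp_succ] at h3
  have h4 := congrArg (fun f : (ZqmMod p n)[X] => (f : PowerSeries (ZqmMod p n))) h3
  simp only [Polynomial.coe_mul] at h4
  rw [← h1, ← h2] at h4
  have u1 := isUnit_coe_of_coeff_zero_eq_one (coeff_zero_qProd (qBar p n) (truncExp p s (k + 1)))
  have u2 := isUnit_coe_of_coeff_zero_eq_one (coeff_zero_qProd (qBar p n) (truncExp p s (k + 2)))
  apply (u1.mul u2).mul_right_cancel
  linear_combination -h4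

/-! ### Limits of power series and membership in `E p` -/

theorem powerSeries_ext_redMod {f g : PowerSeries (Zqp p)}
    (h : ∀ n, PowerSeries.map (redMod p n) f = PowerSeries.map (redMod p n) g) : f = g := by
  refine PowerSeries.ext fun i => ext_redMod p fun n => ?_
  simpa only [PowerSeries.coeff_map] using congrArg (PowerSeries.coeff i) (h n)

/-- Existence of limits for the Gauss norm. -/
theorem exists_powerSeries_lim (h : ℕ → PowerSeries (Zqm p))
    (hh : ∀ n, PowerSeries.map (toMod p n) (h n) =
      PowerSeries.map (toMod p n) (h (n + 1))) :
    ∃ H : PowerSeries (Zqp p), ∀ n,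
      PowerSeries.map (redMod p n) H = PowerSeries.map (toMod p n) (h n) := by
  refine ⟨PowerSeries.mk fun i => AdicCompletion.mk (maxIdeal p) (Zqm p)
    (AdicCompletion.AdicCauchySequence.mk (maxIdeal p) (Zqm p)
      (fun n => PowerSeries.coeff i (h n)) ?_), fun n => ?_⟩
  · intro n
    rw [SModEq.sub_mem]
    have := congrArg (PowerSeries.coeff i) (hh n)
    simp only [PowerSeries.coeff_map, toMod_eq_iff] at this
    simpa using this
  · ext i
    simp only [PowerSeries.coeff_map, PowerSeries.coeff_mk, redMod_mk]
    rfl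

theorem mem_E_of_map_red_eq {H : PowerSeries (Zqp p)} (h : ℕ → PowerSeries (Zqm p))
    (hH : ∀ n, PowerSeries.map (redMod p n) H =
      PowerSeries.map (toMod p n) (h n))
    (hrat : ∀ n, ∃ P Q : (Zqm p)[X], Q.coeff 0 = 1 ∧
      h n * (Q : PowerSeries (Zqm p)) = (P : PowerSeries (Zqm p))) : H ∈ E p := by
  rw [mem_E_iff]
  change ∀ n, ∃ g ∈ ratS p, PowerSeries.map (redMod p n) H = PowerSeries.map (redMod p n) g
  intro n
  obtain ⟨P, Q, hQ, e⟩ := hrat n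
  refine ⟨PowerSeries.map (algebraMap (Zqm p) (Zqp p)) (h n),
    ⟨P.map (algebraMap _ _), Q.map (algebraMap _ _), ?_, ?_⟩, ?_⟩
  · rw [coeff_map, hQ, map_one]
    exact mNorm_one p
  · rw [Polynomial.polynomial_map_coe, Polynomial.polynomial_map_coe, ← map_mul, e]
  · rw [hH]
    ext i
    simp only [PowerSeries.coeff_map]
    exact (redMod_algebraMap p n _).symm

theorem map_redMod_sigmaPS (n : ℕ) (f : PowerSeries (Zqp p)) :
    PowerSeries.map (redMod p n) (sigmaPS p f) =
      PowerSeries.rescale (qBar p n) (PowerSeries.map (redMod p n) f) := by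
  ext i
  simp only [sigmaPS, PowerSeries.coeff_map, PowerSeries.coeff_rescale, map_mul, map_pow, redMod_q]

theorem frobPS_apply (f : PowerSeries (Zqp p)) :
    frobPS p f = PowerSeries.expand p (Fact.out : p.Prime).ne_zero (PowerSeries.map (frob p) f) :=
  rfl

theorem frobPS_X : frobPS p PowerSeries.X = PowerSeries.X ^ p := by
  rw [frobPS_apply, PowerSeries.map_X, PowerSeries.expand_X]

theorem frobPS_C (x : Zqp p) : frobPS p (PowerSeries.C x) = PowerSeries.C (frob p x) := by
  rw [frobPS_apply, PowerSeries.map_C, PowerSeries.expand_C]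

/-- In degree `p j` both sides have coefficient `q ^ (p j) 𝐅_q(a_j)`, since `𝐅_q(q) = q ^ p`; the
other coefficients vanish. -/
theorem sigmaPS_frobPS (f : PowerSeries (Zqp p)) :
    sigmaPS p (frobPS p f) = frobPS p (sigmaPS p f) := by
  have hq : frob p (q p) = q p ^ p := by
    refine ext_redMod p fun n => ?_
    have := redMod_frob_of_eq_pow p (m := 1) ((redMod_q p n).trans (pow_one _).symm)
    rwa [pow_one, ← redMod_q, ← map_pow] at this
  ext i
  simp only [frobPS_apply, sigmaPS, PowerSeries.coeff_rescale, PowerSeries.coeff_expand]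
  split_ifs with h
  · obtain ⟨j, rfl⟩ := h
    rw [Nat.mul_div_cancel_left _ (Fact.out : p.Prime).pos]
    simp [PowerSeries.coeff_rescale, hq, pow_mul]
  · simp

end

variable {p : ℕ} [Fact p.Prime]

/-! ### Fixed points of `𝐅_q` -/

theorem constantCoeff_frobPS (f : PowerSeries (Zqp p)) :
    PowerSeries.constantCoeff (frobPS p f) = frob p (PowerSeries.constantCoeff f) := by
  rw [frobPS_apply, PowerSeries.constantCoeff_expand, ← PowerSeries.coeff_zero_eq_constantCoeff_apply,
    PowerSeries.coeff_map, PowerSeries.coeff_zero_eq_constantCoeff_apply]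

/-- For `n > 0` the coefficient of index `n` is zero or the Frobenius image of the one of index `n /
p < n`, so strong induction kills it. -/
theorem eq_one_of_frobPS_eq_self {g : PowerSeries (Zqp p)} (hg : frobPS p g = g)
    (h0 : PowerSeries.constantCoeff g = 1) : g = 1 := by
  have hp : p.Prime := Fact.out
  have h (n : ℕ) (hn : n ≠ 0) : PowerSeries.coeff n g = 0 := by
    induction n using Nat.strong_induction_on with
    | _ n ih =>
      rw [← hg, frobPS_apply, PowerSeries.coeff_expand]
      split_ifs with hd
      · obtain ⟨m, rfl⟩ := hd
        have hm : m ≠ 0 := by rintro rfl; simp at hn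
        rw [Nat.mul_div_cancel_left _ hp.pos, PowerSeries.coeff_map,
          ih m (lt_mul_of_one_lt_left (Nat.pos_of_ne_zero hm) hp.one_lt) hm, map_zero]
      · rfl
  refine PowerSeries.ext fun n => ?_
  obtain _ | n := n
  · simpa using h0
  · rw [h _ n.succ_ne_zero, PowerSeries.coeff_one, if_neg n.succ_ne_zero]

/-- As `p (n + 1) ≥ n + 2`, `𝐅_q` is contracting for the `z`-adic topology on series without
constant term. -/
theorem X_pow_succ_dvd_frobPS {f : PowerSeries (Zqp p)} {n : ℕ} (h : PowerSeries.X ^ (n + 1) ∣ f) :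
    PowerSeries.X ^ (n + 2) ∣ frobPS p f := by
  have hp : 2 ≤ p := (Fact.out : p.Prime).two_le
  obtain ⟨g, rfl⟩ := h
  rw [map_mul, map_pow, frobPS_X, ← pow_mul]
  exact (pow_dvd_pow _ (by nlinarith)).mul_right _

/-- The infinite product `H · 𝐅_q(H) · 𝐅_q²(H) ⋯`. -/
theorem exists_eq_mul_frobPS {H : PowerSeries (Zqp p)} (hH : PowerSeries.constantCoeff H = 1) :
    ∃ f, PowerSeries.constantCoeff f = 1 ∧ f = H * frobPS p f := by
  -- Partial products: `G j = H 𝐅_q(H) ⋯ 𝐅_q^(j-1)(H)`. Coefficient `i` is final from `G i` on.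
  set G : ℕ → PowerSeries (Zqp p) := fun j => (fun f => H * frobPS p f)^[j] 1 with hG
  have hsucc (j : ℕ) : G (j + 1) = H * frobPS p (G j) := Function.iterate_succ_apply' _ _ _
  have hdvd (j : ℕ) : PowerSeries.X ^ (j + 1) ∣ G (j + 1) - G j := by
    induction j with
    | zero =>
      have e : G (0 + 1) - G 0 = H - 1 := by simp [hG]
      rw [e, zero_add, pow_one, PowerSeries.X_dvd_iff, map_sub, hH, map_one, sub_self]
    | succ j ih =>
      rw [hsucc (j + 1), hsucc j, ← mul_sub, ← map_sub, ← hsucc j]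
      exact (X_pow_succ_dvd_frobPS ih).mul_left _
  have hstab (i j : ℕ) (hij : i ≤ j) : PowerSeries.coeff i (G j) = PowerSeries.coeff i (G i) := by
    induction j, hij using Nat.le_induction with
    | base => rfl
    | succ j hij ih =>
      rw [← ih, ← sub_eq_zero, ← map_sub]
      exact PowerSeries.X_pow_dvd_iff.mp (hdvd j) i (by omega)
  set f : PowerSeries (Zqp p) := PowerSeries.mk fun i => PowerSeries.coeff i (G i) with hf
  have hfG (j : ℕ) : PowerSeries.X ^ (j + 1) ∣ f - G j := by
    rw [PowerSeries.X_pow_dvd_iff]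
    intro i hi
    rw [map_sub, hf, PowerSeries.coeff_mk, hstab i j (by omega), sub_self]
  refine ⟨f, by simp [hf, hG], ?_⟩
  refine PowerSeries.ext fun i => ?_
  have h1 : PowerSeries.X ^ (i + 2) ∣ f - H * frobPS p f := by
    have e : f - H * frobPS p f = (f - G (i + 1)) - H * frobPS p (f - G i) := by
      rw [hsucc, map_sub]; ring
    rw [e]
    exact dvd_sub (hfG (i + 1)) ((X_pow_succ_dvd_frobPS (hfG i)).mul_left _)
  rw [← sub_eq_zero, ← map_sub]
  exact PowerSeries.X_pow_dvd_iff.mp h1 i (by omega)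

/-! ### The transition function -/

theorem exists_transition (p : ℕ) [Fact p.Prime] (s : ℕ) : ∃ H : PowerSeries (Zqp p), ∀ n,
    PowerSeries.map (redMod p n) H = PowerSeries.map (toMod p n) (transApprox p s n) :=
  exists_powerSeries_lim p _ fun _ => map_transApprox_succ p s le_rfl

theorem frobPS_one_sub_C_mul_X (x : Zqp p) :
    frobPS p (1 - PowerSeries.C x * PowerSeries.X) =
      1 - PowerSeries.C (frob p x) * PowerSeries.X ^ p := by
  rw [map_sub, map_one, map_mul, frobPS_C, frobPS_X]

theorem rescale_qProd_mul {S : Type*} [CommRing S] (t : S) (M : ℕ) :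
    PowerSeries.rescale t (qProd t M : S[X]) * (1 - PowerSeries.X) =
      ((qProd t M : S[X]) : PowerSeries S) * (1 - PowerSeries.C (t ^ M) * PowerSeries.X) := by
  have h := congrArg (fun f : S[X] => (f : PowerSeries S)) (qProd_comp_mul t M)
  simpa [coe_comp_C_mul_X] using h

theorem rescale_expand_qProd_mul {S : Type*} [CommRing S] (p : ℕ) (t : S) (M : ℕ) :
    PowerSeries.rescale t (expand S p (qProd (t ^ p) M) : S[X]) * (1 - PowerSeries.X ^ p) =
      ((expand S p (qProd (t ^ p) M) : S[X]) : PowerSeries S) *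
        (1 - PowerSeries.C ((t ^ M) ^ p) * PowerSeries.X ^ p) := by
  have h := congrArg (fun f : S[X] => (f : PowerSeries S)) (expand_qProd_comp_mul p t M)
  simpa [coe_comp_C_mul_X] using h

/-- The `q`-difference equation of one rational approximation, denominators cleared; `(z; t)_N`
cancels because its constant term is `1`. -/
theorem rescale_mul_of_mul_qProd_eq {S : Type*} [CommRing S] {p M N : ℕ} {t : S}
    {h : PowerSeries S}
    (hh : h * (qProd t N : S[X]) = (expand S p (qProd (t ^ p) M) : S[X])) :
    PowerSeries.rescale t h * (1 - PowerSeries.X ^ p) *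
        (1 - PowerSeries.C (t ^ N) * PowerSeries.X) =
      (1 - PowerSeries.X) * h * (1 - PowerSeries.C ((t ^ M) ^ p) * PowerSeries.X ^ p) := by
  have h1 := rescale_qProd_mul t N
  have h2 := rescale_expand_qProd_mul p t M
  have h3 := congrArg (PowerSeries.rescale t) hh
  rw [map_mul] at h3
  have u := isUnit_coe_of_coeff_zero_eq_one (coeff_zero_qProd t N)
  apply u.mul_right_cancel
  calc
    _ = (PowerSeries.rescale t h * PowerSeries.rescale t (qProd t N : S[X])) *
        (1 - PowerSeries.X ^ p) * (1 - PowerSeries.X) := by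
      linear_combination (-PowerSeries.rescale t h * (1 - PowerSeries.X ^ p)) * h1
    _ = _ := by
      rw [h3, h2, ← hh]
      ring

/-- The denominator of `R_n` involves `m_{n + 1}` and its numerator `m_n`; modulo `𝔪 ^ n` both
exponents yield the same power of `q`, namely `q ^ β`. -/
theorem qBar_pow_truncExp_succ (s n : ℕ) :
    qBar p n ^ truncExp p s (n + 1) = qBar p n ^ truncExp p s n := by
  rw [truncExp_succ, pow_add, mul_comm s, pow_mul, qBar_pow_prime_pow p le_rfl, one_pow, mul_one]

variable {s : ℕ} {H : PowerSeries (Zqp p)}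

theorem transition_mem_E (hH : ∀ n, PowerSeries.map (redMod p n) H =
    PowerSeries.map (toMod p n) (transApprox p s n)) : H ∈ E p :=
  mem_E_of_map_red_eq p (transApprox p s) hH fun n =>
    ⟨_, _, coeff_zero_qProd _ _, transApprox_mul p s n⟩

theorem constantCoeff_transApprox (s n : ℕ) :
    PowerSeries.constantCoeff (transApprox p s n) = 1 := by
  have h := congrArg PowerSeries.constantCoeff (transApprox_mul p s n)
  simpa [coeff_zero_qProd, coeff_zero_expand_qProd] using h

theorem constantCoeff_transition (hH : ∀ n, PowerSeries.map (redMod p n) H =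
    PowerSeries.map (toMod p n) (transApprox p s n)) : PowerSeries.constantCoeff H = 1 := by
  refine ext_redMod p fun n => ?_
  have h := congrArg (PowerSeries.coeff 0) (hH n)
  rw [PowerSeries.coeff_map, PowerSeries.coeff_map] at h
  simpa [constantCoeff_transApprox] using h

/-- The inverse is approximated by the `1 / R_n`, whose denominators `(z ^ p; q ^ p)_{m_n}` also
have constant term `1`. -/
theorem transition_inv_mem_E {K : PowerSeries (Zqp p)}
    (hH : ∀ n, PowerSeries.map (redMod p n) H =
      PowerSeries.map (toMod p n) (transApprox p s n)) (hK : H * K = 1) : K ∈ E p := by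
  have hinv (n : ℕ) : transApprox p s n * PowerSeries.invOfUnit (transApprox p s n) 1 = 1 :=
    PowerSeries.mul_invOfUnit _ _ (by simpa using constantCoeff_transApprox s n)
  refine mem_E_of_map_red_eq p (fun n => PowerSeries.invOfUnit (transApprox p s n) 1)
    (fun n => ?_) fun n => ⟨qProd (qm p) (truncExp p s (n + 1)),
      expand _ p (qProd (qm p ^ p) (truncExp p s n)), coeff_zero_expand_qProd p _ _, ?_⟩
  · have h1 := congrArg (PowerSeries.map (redMod p n)) hK
    have h2 := congrArg (PowerSeries.map (toMod p n)) (hinv n)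
    rw [map_mul, map_one, hH] at h1
    rw [map_mul, map_one] at h2
    exact (left_inv_eq_right_inv ((mul_comm _ _).trans h1) h2)
  · rw [← transApprox_mul p s n, ← mul_assoc, mul_comm (PowerSeries.invOfUnit _ _), hinv, one_mul]

theorem sigmaPS_transition_mul {β : ℤ_[p]}
    (hβ : ∀ n, redMod p n (qPow p β) = qBar p n ^ truncExp p s n)
    (hH : ∀ n, PowerSeries.map (redMod p n) H =
      PowerSeries.map (toMod p n) (transApprox p s n)) :
    sigmaPS p H * frobPS p (1 - PowerSeries.X) *
        (1 - PowerSeries.C (qPow p β) * PowerSeries.X) =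
      (1 - PowerSeries.X) * H * frobPS p (1 - PowerSeries.C (qPow p β) * PowerSeries.X) := by
  refine powerSeries_ext_redMod p fun n => ?_
  have h := rescale_mul_of_mul_qProd_eq (map_transApprox_mul p s n n)
  rw [qBar_pow_truncExp_succ, ← redMod_frob_of_eq_pow p (hβ n), ← hH n, ← hβ n] at h
  rw [frobPS_one_sub_C_mul_X, map_sub (frobPS p), map_one (frobPS p), frobPS_X]
  simp only [map_mul, map_sub, map_one, map_pow, PowerSeries.map_X, PowerSeries.map_C,
    map_redMod_sigmaPS]
  exact h

theorem isUnit_one_sub_C_mul_X (x : Zqp p) :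
    IsUnit (1 - PowerSeries.C x * PowerSeries.X : PowerSeries (Zqp p)) :=
  isUnit_of_constantCoeff_eq_one (by simp)

theorem sigmaPS_transition {β : ℤ_[p]}
    (hβ : ∀ n, redMod p n (qPow p β) = qBar p n ^ truncExp p s n)
    (hH : ∀ n, PowerSeries.map (redMod p n) H =
      PowerSeries.map (toMod p n) (transApprox p s n)) :
    sigmaPS p H * frobPS p (hypSeries β) = hypSeries β * H := by
  have h := sigmaPS_transition_mul hβ hH
  have u := isUnit_one_sub_C_mul_X (qPow p β)
  apply (u.mul (u.map (frobPS p))).mul_right_cancel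
  rw [← hypSeries_mul β, map_mul] at h
  linear_combination h

/-! ### Identification of the infinite product with `f_α` -/

/-- The solution of `f = H · 𝐅_q(f)` is a solution of the `q`-hypergeometric equation. -/
theorem sigmaPS_eq_mul {A f : PowerSeries (Zqp p)} (hA : PowerSeries.constantCoeff A = 1)
    (hf0 : PowerSeries.constantCoeff f = 1) (hf : f = H * frobPS p f)
    (hHA : sigmaPS p H * frobPS p A = A * H) : sigmaPS p f = A * f := by
  obtain ⟨v, hv⟩ : IsUnit (A * f) :=
    isUnit_of_constantCoeff_eq_one (by rw [map_mul, hA, hf0, one_mul])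
  -- `g = σ_q(f) / (A f)`; the relation `hHA` and `σ_q 𝐅_q = 𝐅_q σ_q` make it a fixed point of
  -- `𝐅_q`.
  set g := sigmaPS p f * ↑v⁻¹ with hg
  have hgv : g * (A * f) = sigmaPS p f := by rw [hg, ← hv, Units.inv_mul_cancel_right]
  have h0 : PowerSeries.constantCoeff (sigmaPS p f) = 1 := by
    rw [← PowerSeries.coeff_zero_eq_constantCoeff_apply, sigmaPS, PowerSeries.coeff_rescale,
      pow_zero, one_mul, PowerSeries.coeff_zero_eq_constantCoeff_apply, hf0]
  have hg1 : g = 1 := by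
    refine eq_one_of_frobPS_eq_self ?_ ?_
    · apply (hv ▸ v.isUnit : IsUnit (A * f)).mul_right_cancel
      rw [hgv]
      have h1 : frobPS p g * (frobPS p A * frobPS p f) = frobPS p (sigmaPS p f) := by
        rw [← map_mul, ← map_mul, hgv]
      calc frobPS p g * (A * f) = frobPS p g * (A * (H * frobPS p f)) := by rw [← hf]
        _ = sigmaPS p H * (frobPS p g * (frobPS p A * frobPS p f)) := by
          linear_combination (-frobPS p g * frobPS p f) * hHA
        _ = sigmaPS p f := by
          rw [h1, ← sigmaPS_frobPS, ← map_mul, ← hf]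
    · have h2 := congrArg PowerSeries.constantCoeff hgv
      rwa [map_mul, map_mul _ A f, hA, hf0, mul_one, mul_one, h0] at h2
  rw [← hgv, hg1, one_mul]

theorem constantCoeff_hypSeries (β : ℤ_[p]) : PowerSeries.constantCoeff (hypSeries β) = 1 := by
  have h := congrArg PowerSeries.constantCoeff (hypSeries_mul β)
  simpa using h

theorem isQHypSeries_of_sigmaPS_eq {β : ℤ_[p]} {f : PowerSeries (Zqp p)}
    (hf0 : PowerSeries.constantCoeff f = 1) (hf : sigmaPS p f = hypSeries β * f) :
    IsQHypSeries β f := by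
  have h : sigmaPS p f - PowerSeries.C (qPow p β) * (sigmaPS p f * PowerSeries.X) =
      f - f * PowerSeries.X := by
    have := hypSeries_mul β
    linear_combination (1 - PowerSeries.C (qPow p β) * PowerSeries.X) * hf + f * this
  have hrec (n : ℕ) : PowerSeries.coeff (n + 1) f * (1 - q p * q p ^ n) =
      PowerSeries.coeff n f * (1 - qPow p β * q p ^ n) := by
    have hn := congrArg (PowerSeries.coeff (n + 1)) h
    simp only [map_sub, PowerSeries.coeff_C_mul, PowerSeries.coeff_succ_mul_X, sigmaPS,
      PowerSeries.coeff_rescale] at hn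
    linear_combination -hn
  intro n
  induction n with
  | zero => simpa [qPochhammer] using hf0
  | succ n ih =>
    have e (x : Zqp p) : qPochhammer x (n + 1) = qPochhammer x n * (1 - x * q p ^ n) :=
      Finset.prod_range_succ _ _
    rw [e, e, ← ih]
    linear_combination (qPochhammer (q p) n) * hrec n

/-! ### Uniqueness of the quotients -/

theorem one_sub_qm_pow_ne_zero {n : ℕ} (hn : n ≠ 0) : 1 - qm p ^ n ≠ 0 := by
  have hinj : Function.Injective (algebraMap ℤ[X] (Zqm p)) :=
    IsLocalization.injective _ (mIdeal p).primeCompl_le_nonZeroDivisors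
  have e : 1 - qm p ^ n = algebraMap ℤ[X] (Zqm p) (-(X ^ n - C 1)) := by simp [qm]
  rw [e, Ne, map_eq_zero_iff _ hinj, neg_eq_zero]
  exact X_pow_sub_C_ne_zero (Nat.pos_of_ne_zero hn) 1

/-- `ℤ[q]_𝔪` is a Noetherian domain, so its completion is flat and nonzero elements remain regular
on it. -/
theorem isRegular_one_sub_q_pow {n : ℕ} (hn : n ≠ 0) : IsRegular (1 - q p ^ n) := by
  have : IsNoetherianRing (Zqm p) :=
    IsLocalization.isNoetherianRing (mIdeal p).primeCompl (Zqm p)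
      (inferInstanceAs (IsNoetherianRing ℤ[X]))
  have : IsDomain (Zqm p) :=
    IsLocalization.isDomain_localization (mIdeal p).primeCompl_le_nonZeroDivisors
  have h : IsSMulRegular (Zqp p) (1 - qm p ^ n) :=
    Module.Flat.isSMulRegular_of_nonZeroDivisors
      (mem_nonZeroDivisors_of_ne_zero (one_sub_qm_pow_ne_zero hn))
  have e : 1 - q p ^ n = algebraMap (Zqm p) (Zqp p) (1 - qm p ^ n) := by
    rw [map_sub, map_one, map_pow]
    rfl
  rw [← isLeftRegular_iff_isRegular]
  intro x y hxy
  apply h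
  have hsmul (z : Zqp p) : (1 - qm p ^ n) • z = (1 - q p ^ n) * z := by
    rw [e]
    exact Algebra.smul_def (1 - qm p ^ n) z
  exact (hsmul x).trans (hxy.trans (hsmul y).symm)

theorem isRegular_qPochhammer_q (n : ℕ) : IsRegular (qPochhammer (q p) n) := by
  induction n with
  | zero => simpa [qPochhammer] using isRegular_one
  | succ n ih =>
    rw [qPochhammer, Finset.prod_range_succ, ← pow_succ']
    exact ih.mul (isRegular_one_sub_q_pow n.succ_ne_zero)

theorem IsQHypSeries.unique {β : ℤ_[p]} {f g : PowerSeries (Zqp p)} (hf : IsQHypSeries β f)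
    (hg : IsQHypSeries β g) : g = f :=
  PowerSeries.ext fun n => (isRegular_qPochhammer_q n).right ((hg n).trans (hf n).symm)

/-! ### The `p`-adic exponent -/

theorem qBar_pow_eq_of_dvd_sub {n a b : ℕ} (h : (p ^ n : ℤ) ∣ (a : ℤ) - b) :
    qBar p n ^ a = qBar p n ^ b := by
  have hone := qBar_pow_prime_pow p (le_refl n)
  have hmod : a ≡ b [MOD p ^ n] := by
    rw [Nat.ModEq.comm, Nat.modEq_iff_dvd]
    exact_mod_cast h
  rw [← Nat.mod_add_div a (p ^ n), ← Nat.mod_add_div b (p ^ n), pow_add, pow_add, pow_mul, pow_mul,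
    hone, one_pow, one_pow, hmod]

theorem redMod_qPow_of_eq {β : ℤ_[p]} (hβ : (1 - p) * (β - 1) = s) (n : ℕ) :
    redMod p n (qPow p β) = qBar p n ^ truncExp p s n := by
  have h1 : redMod p n (qPow p β) = qBar p n ^ β.appr n :=
    (redMod_mk p n _).trans (map_pow _ _ _)
  rw [h1]
  apply qBar_pow_eq_of_dvd_sub
  rw [← PadicInt.pow_p_dvd_int_iff]
  have h2 : (p : ℤ_[p]) ^ n ∣ β - β.appr n := Ideal.mem_span_singleton.mp (PadicInt.appr_spec n β)
  have hu : IsUnit (1 - p : ℤ_[p]) := by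
    by_contra hcon
    have hm : (1 : ℤ_[p]) ∈ nonunits ℤ_[p] := by
      have := IsLocalRing.nonunits_add hcon (PadicInt.p_nonunit : (p : ℤ_[p]) ∈ nonunits ℤ_[p])
      simp at this
    exact hm isUnit_one
  -- Summing the geometric progression gives `(1 - p) (β - m_n) = s p ^ n`, and `1 - p` is a unit.
  have h3 : (p : ℤ_[p]) ^ n ∣ β - truncExp p s n := by
    rw [← hu.dvd_mul_left]
    refine ⟨s, ?_⟩
    have hgeom := mul_neg_geom_sum (p : ℤ_[p]) n
    rw [truncExp]
    push_cast
    linear_combination hβ - s * hgeom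
  have h4 := dvd_sub h3 h2
  push_cast
  convert h4 using 1
  ring

theorem exists_nat_one_sub_mul_sub_one_eq {α : ℚ} {a : ℤ} {b : ℕ} (hb : 0 < b) (hα : α = a / b)
    (hα1 : α ≤ 1) (hp : p ≡ 1 [MOD b]) {β : ℤ_[p]} (hβ : (β : ℚ_[p]) = α) :
    ∃ s : ℕ, (1 - p) * (β - 1) = s := by
  obtain ⟨c, hc⟩ := (Nat.modEq_iff_dvd' (Fact.out : p.Prime).one_lt.le).mp hp.symm
  have hpc : p = 1 + b * c := by have := (Fact.out : p.Prime).one_lt; omega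
  have hb' : (b : ℚ) ≠ 0 := by exact_mod_cast hb.ne'
  have hab : a ≤ b := by
    have hbq : (0 : ℚ) < b := by exact_mod_cast hb
    rw [hα, div_le_one hbq] at hα1
    exact_mod_cast hα1
  -- `s = (b - a) c`; `α ≤ 1` makes it nonnegative.
  obtain ⟨s, hs⟩ := Int.eq_ofNat_of_zero_le (mul_nonneg (sub_nonneg.mpr hab) (Int.natCast_nonneg c))
  refine ⟨s, ?_⟩
  have hbβ : (b : ℤ_[p]) * β = a := by
    apply PadicInt.ext
    push_cast
    rw [hβ, hα]
    have : (b : ℚ) * (a / b) = a := mul_div_cancel₀ _ hb'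
    exact_mod_cast congrArg (fun x : ℚ => (x : ℚ_[p])) this
  have hs' : ((b : ℤ_[p]) - a) * c = s := by exact_mod_cast congrArg (fun x : ℤ => (x : ℤ_[p])) hs
  have hpc' : (p : ℤ_[p]) = 1 + b * c := by exact_mod_cast congrArg (fun x : ℕ => (x : ℤ_[p])) hpc
  rw [hpc', ← hs']
  linear_combination (-(c : ℤ_[p])) * hbβ

/-! ### The transition matrix and the theorem -/

theorem isFrobeniusTransition_hypOp {β : ℤ_[p]} (H : (E p)ˣ)
    (hH : sigmaPS p ((H : E p) : PowerSeries (Zqp p)) * frobPS p (hypSeries β) =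
      hypSeries β * ((H : E p) : PowerSeries (Zqp p))) :
    (hypOp β).IsFrobeniusTransition 1 (Matrix.of fun _ _ => (H : E p)) := by
  constructor
  · rw [Matrix.isUnit_iff_isUnit_det, Matrix.det_fin_one]
    exact H.isUnit
  · refine Matrix.ext fun i j => Subtype.ext ?_
    simp [Matrix.mul_apply, QDiffOp.companion, hypOp, Subsingleton.elim i 0]
    exact hH

end

end QFrob

theorem theorem4 (p : ℕ) [Fact p.Prime] (α : ℚ) (a : ℤ) (b : ℕ) (hb : 0 < b)
    (hα : α = a / b) (hα0 : 0 < α) (hα1 : α ≤ 1) (hp : p ≡ 1 [MOD b]) :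
    let β : ℤ_[p] := ⟨(α : ℚ_[p]), QFrob.norm_ratCast_le_one hα hp⟩
    (QFrob.hypOp β).HasStrongFrobeniusStructure 1 ∧
    ∃ f : PowerSeries (QFrob.Zqp p),
      QFrob.IsQHypSeries β f ∧ (∀ g, QFrob.IsQHypSeries β g → g = f) ∧
      ∃ u : (PowerSeries (QFrob.Zqp p))ˣ, (u : PowerSeries (QFrob.Zqp p)) = QFrob.frobPS p f ∧
      ∃ H : (QFrob.E p)ˣ,
        ((H : QFrob.E p) : PowerSeries (QFrob.Zqp p)) = f * (u⁻¹ : (PowerSeries (QFrob.Zqp p))ˣ) ∧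
        (QFrob.hypOp β).IsFrobeniusTransition 1 (Matrix.of fun _ _ => (H : QFrob.E p)) := by
  intro β
  obtain ⟨s, hs⟩ := QFrob.exists_nat_one_sub_mul_sub_one_eq hb hα hα1 hp (β := β) rfl
  have hβ := QFrob.redMod_qPow_of_eq hs
  obtain ⟨h, hh⟩ := QFrob.exists_transition p s
  have h0 := QFrob.constantCoeff_transition hh
  have hA := QFrob.sigmaPS_transition hβ hh
  obtain ⟨f, hf0, hf⟩ := QFrob.exists_eq_mul_frobPS h0
  have hqf : QFrob.IsQHypSeries β f := QFrob.isQHypSeries_of_sigmaPS_eq hf0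
    (QFrob.sigmaPS_eq_mul (QFrob.constantCoeff_hypSeries β) hf0 hf hA)
  obtain ⟨v, hv⟩ := QFrob.isUnit_of_constantCoeff_eq_one h0
  have hv' : h * ↑v⁻¹ = 1 := by rw [← hv, Units.mul_inv]
  obtain ⟨u, hu⟩ : IsUnit (QFrob.frobPS p f) :=
    QFrob.isUnit_of_constantCoeff_eq_one (by rw [QFrob.constantCoeff_frobPS, hf0, map_one])
  let H : (QFrob.E p)ˣ :=
    { val := ⟨h, QFrob.transition_mem_E hh⟩
      inv := ⟨(v⁻¹ : (PowerSeries (QFrob.Zqp p))ˣ), QFrob.transition_inv_mem_E hh hv'⟩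
      val_inv := Subtype.ext hv'
      inv_val := Subtype.ext ((mul_comm _ _).trans hv') }
  have hH : (QFrob.hypOp β).IsFrobeniusTransition 1 (Matrix.of fun _ _ => (H : QFrob.E p)) :=
    QFrob.isFrobeniusTransition_hypOp H hA
  refine ⟨⟨one_pos, _, hH⟩, f, hqf, fun g hg => hqf.unique hg, u, hu, H, ?_, hH⟩
  -- `H = f / 𝐅_q(f)` is the defining equation `f = H 𝐅_q(f)` of `f`.
  rw [Units.eq_mul_inv_iff_mul_eq, hu]
  exact hf.symm
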